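/- Let $k$ be an algebraically closed field with $\operatorname{char} k \neq 2$ and let $H$ be a semisimple Hopf algebra over $k$; if $\operatorname{char} k = p > 0$, assume also that $H^*$ is semisimple. Let $G$ and $L$ be finite groups and let $$(kG)^* \xhookrightarrow{\ i\ } H \xrightarrow{\ \pi\ } kL$$ be a cocentral abelian extension: $i$ is an injective and $\pi$ a surjective Hopf algebra map, $K = i((kG)^*)$ is normal in $H$, $\ker \pi = HK^+$ (where $K^+$ is the augmentation ideal of $K$), and $(kL)^*$, embedded in $H^*$ by $f \mapsto f\circ\pi$, lies in the centre of $H^*$. Let $\{p_g\}_{g\in G}$ be the basis of $(kG)^*$ dual to $G$, and write $H = (kG)^* \#_\sigma^\tau kL$ as a bicrossed product. Thus the elements $p_g\bar x$ ($g\in G$, $x\in L$), where $\bar x = 1\# x$, form a basis of $H$, with $\bar 1 = 1$ and $\pi(\bar x) = x$; there is an action $\rightharpoonup$ of $L$ on the set $G$ with $\bar x\, p_g = p_{x\rightharpoonup g}\,\bar x$; there is an invertible normalized cocycle $\sigma(x,y)=\sum_{g}\sigma_g(x,y)\,p_g$ with $\bar x\,\bar y=\sigma(x,y)\,\overline{xy}$;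 and there is an invertible normalized dual cocycle $\tau(x)=\sum_{g,h}\tau_{g,h}(x)\,p_g\otimes p_h$ with $\Delta(\bar x)=\tau(x)(\bar x\otimes\bar x)$ (the coaction of $(kG)^*$ on $kL$ being trivial because the extension is cocentral). Write $\sigma_g^{-1}(x,y)$ and $\tau_{g,h}^{-1}(x)$ for the inverses in $k$ of $\sigma_g(x,y)$ and $\tau_{g,h}(x)$. Then $H$ has a unique integral $\Lambda$ with $\varepsilon(\Lambda)=1$, and $H$ has only finitely many simple characters, that is, characters $\chi\colon H\to k$ of simple $H$-modules. With $\nu(\chi)=\chi\left(\sum \Lambda_1\Lambda_2\right)$ denoting the Frobenius–Schur indicator of $\chi$, one has in $k$ $$\sum_{\chi} \nu(\chi)\,\chi(1_H) = \sum_{\substack{(g,x)\in G\times L\\ x^2=1,\ x\rightharpoonup g=g^{-1}}} \sigma_g^{-1}(x,x)\,\tau_{g,g^{-1}}^{-1}(x),$$ where the sum on the left is over all simple characters $\chi$ of $H$. In particular, if both $\sigma$ and $\tau$ are trivial (that is, $\sigma_g(x,y)=1$ and $\tau_{g,h}(x)=1$ for all $g,h\in G$ and $x,y\in L$), then $$\sum_{\chi}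 \nu(\chi)\,\chi(1_H) = \left|\{(g,x)\in G\times L \mid x^2=1,\ x\rightharpoonup g=g^{-1}\}\right| .$$ -/

import Mathlib

open scoped TensorProduct

/-! ### The Hopf algebra `(kG)^*` of functions on a finite group -/

/-- `(kG)^*`, the Hopf algebra dual to the group algebra `kG` of a finite group `G`:
functions `G → k` with pointwise multiplication. -/
def DualGroupAlgebra (k G : Type*) : Type _ := G → k

namespace DualGroupAlgebra

variable (k G : Type*) [Field k]

instance : CommRing (DualGroupAlgebra k G) := inferInstanceAs (CommRing (G → k))

instance : Algebra k (DualGroupAlgebra k G) := inferInstanceAs (Algebra k (G → k))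

variable {G}

/-- The element `p_g` of the basis of `(kG)^*` dual to the basis `G` of `kG`. -/
def p [DecidableEq G] (g : G) : DualGroupAlgebra k G := Pi.single g (1 : k)

variable (G)

/-- The counit `f ↦ f 1`. -/
def counitHom [Group G] : DualGroupAlgebra k G →ₗ[k] k := LinearMap.proj (1 : G)

/-- The comultiplication, dual to the multiplication of `G`: `f` goes to the function
`(a, b) ↦ f (a * b)`. Thus `p_g` goes to the sum of `p_a ⊗ p_b` over all `a * b = g`. -/
noncomputable def comulHom [Group G] [Fintype G] [DecidableEq G] :
    DualGroupAlgebra k G →ₗ[k] DualGroupAlgebra k G ⊗[k] DualGroupAlgebra k G where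
  toFun f := ∑ a : G, ∑ b : G, f (a * b) • (p k a ⊗ₜ[k] p k b)
  map_add' f f' := by
    have h : ∀ x : G, (f + f') x = f x + f' x := fun _ => rfl
    simp only [h, add_smul, Finset.sum_add_distrib]
  map_smul' c f := by
    have h : ∀ x : G, (c • f) x = c * f x := fun _ => rfl
    simp only [h, mul_smul, Finset.smul_sum, RingHom.id_apply]

/-- The antipode, given by `(S f) g = f g⁻¹`. -/
def antipodeHom [Group G] : DualGroupAlgebra k G →ₗ[k] DualGroupAlgebra k G :=
  LinearMap.funLeft k k (fun g : G => g⁻¹)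

variable {k G}

lemma p_apply [DecidableEq G] (g h : G) :
    (p k g : DualGroupAlgebra k G) h = if h = g then 1 else 0 := by
  simp [p, Pi.single_apply]

lemma p_mul_p [DecidableEq G] (g h : G) : p k g * p k h = if g = h then p k g else 0 := by
  funext x
  change p k g x * p k h x = _
  split_ifs with hgh
  · subst hgh
    by_cases hx : x = g <;> simp [p_apply, hx]
  · change _ = (0 : k)
    simp only [p_apply]
    split_ifs with h1 h2 <;> simp_all

lemma sum_p [DecidableEq G] [Fintype G] : ∑ g : G, p k g = 1 := by
  exact Finset.univ_sum_single (1 : G → k)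

lemma eq_sum [DecidableEq G] [Fintype G] (f : DualGroupAlgebra k G) :
    f = ∑ g : G, f g • p k g := by
  have h : ∀ g : G, f g • p k g = Pi.single (M := fun _ : G => k) g (f g) := by
    intro g
    funext x
    change f g * p k g x = _
    rw [p_apply, Pi.single_apply]
    simp
  rw [Finset.sum_congr rfl (fun g _ => h g)]
  exact (Finset.univ_sum_single (f : G → k)).symm

lemma hom_ext [DecidableEq G] [Fintype G] {M : Type*} [AddCommMonoid M] [Module k M]
    {φ ψ : DualGroupAlgebra k G →ₗ[k] M} (h : ∀ g, φ (p k g) = ψ (p k g)) : φ = ψ := by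
  ext f
  rw [eq_sum f]
  simp [h]

variable [Group G]

lemma counitHom_p [DecidableEq G] (g : G) : counitHom k G (p k g) = if g = 1 then 1 else 0 := by
  change p k g 1 = _
  rw [p_apply]
  simp [eq_comm]

lemma antipodeHom_p [DecidableEq G] (g : G) : antipodeHom k G (p k g) = p k g⁻¹ := by
  funext x
  change p k g x⁻¹ = _
  simp [p_apply, inv_eq_iff_eq_inv]

variable [Fintype G] [DecidableEq G]

lemma comulHom_apply (f : DualGroupAlgebra k G) :
    comulHom k G f = ∑ a : G, ∑ b : G, f (a * b) • (p k a ⊗ₜ[k] p k b) :=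
  rfl

lemma comulHom_p (g : G) :
    comulHom k G (p k g) = ∑ a : G, p k a ⊗ₜ[k] p k (a⁻¹ * g) := by
  rw [comulHom_apply]
  refine Finset.sum_congr rfl fun a _ => ?_
  rw [Finset.sum_eq_single (a⁻¹ * g)]
  · simp [p_apply]
  · intro b _ hb
    have : a * b ≠ g := fun h => hb (by simp [← h])
    simp [p_apply, this]
  · simp

noncomputable instance : Coalgebra k (DualGroupAlgebra k G) where
  comul := comulHom k G
  counit := counitHom k G
  coassoc := by
    apply hom_ext
    intro g
    simp only [LinearMap.comp_apply, comulHom_p, map_sum, LinearMap.rTensor_tmul,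
      LinearMap.lTensor_tmul, LinearEquiv.coe_coe, TensorProduct.sum_tmul,
      TensorProduct.tmul_sum, TensorProduct.assoc_tmul]
    rw [Finset.sum_comm]
    refine Finset.sum_congr rfl fun a _ => ?_
    exact Fintype.sum_equiv (Equiv.mulLeft a⁻¹) _ _ (fun b => by simp [mul_assoc])
  rTensor_counit_comp_comul := by
    apply hom_ext
    intro g
    simp only [LinearMap.comp_apply, comulHom_p, map_sum, LinearMap.rTensor_tmul, counitHom_p]
    rw [Finset.sum_eq_single 1] <;> simp +contextual
  lTensor_counit_comp_comul := by
    apply hom_ext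
    intro g
    simp only [LinearMap.comp_apply, comulHom_p, map_sum, LinearMap.lTensor_tmul, counitHom_p]
    rw [Finset.sum_eq_single g]
    · simp
    · intro b _ hb
      have : b⁻¹ * g ≠ 1 := fun h => hb (inv_mul_eq_one.mp h)
      simp [this]
    · simp

lemma counit_apply (f : DualGroupAlgebra k G) : Coalgebra.counit (R := k) f = f 1 := rfl

lemma comul_apply (f : DualGroupAlgebra k G) : Coalgebra.comul (R := k) f =
    ∑ a : G, ∑ b : G, f (a * b) • (p k a ⊗ₜ[k] p k b) := comulHom_apply f

lemma comul_p (g : G) : Coalgebra.comul (R := k) (p k g) =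
    ∑ a : G, p k a ⊗ₜ[k] p k (a⁻¹ * g) := comulHom_p g

noncomputable instance : Bialgebra k (DualGroupAlgebra k G) :=
  Bialgebra.mk' k (DualGroupAlgebra k G) rfl (fun {_ _} => rfl)
    (by
      have h1 : ∀ a b : G, (1 : DualGroupAlgebra k G) (a * b) = (1 : k) := fun _ _ => rfl
      simp only [comul_apply, h1, one_smul, ← TensorProduct.tmul_sum, ← TensorProduct.sum_tmul,
        sum_p, Algebra.TensorProduct.one_def])
    (by
      intro f f'
      have hm : ∀ x : G, (f * f') x = f x * f' x := fun _ => rfl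
      simp only [comul_apply, Finset.sum_mul_sum, hm]
      symm
      refine Finset.sum_congr rfl fun a _ => ?_
      rw [Finset.sum_eq_single a]
      · refine Finset.sum_congr rfl fun b _ => ?_
        rw [Finset.sum_eq_single b]
        · rw [smul_mul_smul_comm]
          simp [Algebra.TensorProduct.tmul_mul_tmul, p_mul_p]
        · intro b' _ hb
          rw [smul_mul_smul_comm]
          simp [Algebra.TensorProduct.tmul_mul_tmul, p_mul_p, hb.symm]
        · simp
      · intro a' _ ha
        refine Finset.sum_eq_zero fun b _ => Finset.sum_eq_zero fun b' _ => ?_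
        rw [smul_mul_smul_comm]
        simp [Algebra.TensorProduct.tmul_mul_tmul, p_mul_p, ha.symm]
      · simp)

noncomputable instance : HopfAlgebra k (DualGroupAlgebra k G) where
  antipode := antipodeHom k G
  mul_antipode_rTensor_comul := by
    apply hom_ext
    intro g
    simp only [LinearMap.comp_apply, comul_p, map_sum, LinearMap.rTensor_tmul, antipodeHom_p,
      LinearMap.mul'_apply, p_mul_p, counit_apply, p_apply]
    by_cases hg : g = 1
    · subst hg
      have := Fintype.sum_equiv (Equiv.inv G) (fun a => p k a⁻¹) (fun a => p k a) (fun _ => rfl)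
      simpa [sum_p] using this
    · simp [hg, Ne.symm hg]
  mul_antipode_lTensor_comul := by
    apply hom_ext
    intro g
    simp only [LinearMap.comp_apply, comul_p, map_sum, LinearMap.lTensor_tmul, antipodeHom_p,
      LinearMap.mul'_apply, p_mul_p, counit_apply, p_apply]
    by_cases hg : g = 1
    · subst hg
      simp [sum_p]
    · simp [hg, Ne.symm hg]

end DualGroupAlgebra

/-! ### Abelian extensions -/

section Adjoint

variable (k : Type*) {H : Type*} [Field k] [Ring H] [HopfAlgebra k H]

/-- The left adjoint action `∑ h₁ a S(h₂)` of `h` on `a`. -/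
noncomputable def leftAdjoint (h a : H) : H :=
  LinearMap.mul' k H (TensorProduct.map LinearMap.id
    (LinearMap.mulLeft k a ∘ₗ HopfAlgebra.antipode k) (Coalgebra.comul (R := k) h))

/-- The right adjoint action `∑ S(h₁) a h₂` of `h` on `a`. -/
noncomputable def rightAdjoint (h a : H) : H :=
  LinearMap.mul' k H (TensorProduct.map (HopfAlgebra.antipode k)
    (LinearMap.mulLeft k a) (Coalgebra.comul (R := k) h))

end Adjoint

/-- An abelian extension `(kG)^* ↪ H ↠ kL`: the image `K` of `(kG)^*` is a normal Hopf
subalgebra of `H`, and `kL` is the quotient `H / H K⁺`. -/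
structure AbelianExtension (k H G L : Type*) [Field k] [Ring H] [HopfAlgebra k H]
    [Group G] [Fintype G] [DecidableEq G] [Group L] where
  /-- the inclusion `i` -/
  incl : DualGroupAlgebra k G →ₐc[k] H
  /-- the projection `π` -/
  proj : H →ₐc[k] MonoidAlgebra k L
  incl_injective : Function.Injective incl
  proj_surjective : Function.Surjective proj
  leftAdjoint_mem : ∀ (h : H) (w : DualGroupAlgebra k G),
    leftAdjoint k h (incl w) ∈ Set.range incl
  rightAdjoint_mem : ∀ (h : H) (w : DualGroupAlgebra k G),
    rightAdjoint k h (incl w) ∈ Set.range incl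
  /-- The kernel of `π` is the left ideal `H K⁺`. -/
  ker_proj : RingHom.ker proj =
    Ideal.span (incl '' {w : DualGroupAlgebra k G | Coalgebra.counit (R := k) w = 0})

namespace AbelianExtension

variable {k H G L : Type*} [Field k] [Ring H] [HopfAlgebra k H]
  [Group G] [Fintype G] [DecidableEq G] [Group L]

/-- The extension is cocentral if `(kL)^*`, embedded in `H^*` by `f ↦ f ∘ π`, lies in the centre
of the algebra `H^*` (whose product is the convolution product). -/
def IsCocentral (E : AbelianExtension k H G L) : Prop :=
  ∀ f : MonoidAlgebra k L →ₗ[k] k,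
    WithConv.toConv (f ∘ₗ (E.proj : H →ₗ[k] MonoidAlgebra k L)) ∈
      Set.center (WithConv (H →ₗ[k] k))

/-- A realization of the extension `(kG)^* ↪ H ↠ kL` as a bicrossed product
`H = (kG)^* #_σ^τ kL`. With `x̄` denoting the element `1 # x`, each element of `H` is uniquely
`∑ x, w_x x̄` with `w_x` in `(kG)^*`, and the structure of `H` is given by an action of `L` on `G`
(through which `L` acts on `(kG)^*`), a coaction `x ↦ ∑ h, (coact h x) ⊗ p_h` of `(kG)^*` on `kL`,
an invertible normalized cocycle `σ(x, y) = ∑ g, σ_g(x, y) p_g` and an invertible normalized dual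
cocycle `τ(x) = ∑ g h, τ_{g,h}(x) p_g ⊗ p_h`. The (dual) cocycle conditions and the normalization
are the associativity, coassociativity, unit and counit laws of `H`. -/
structure BicrossedProduct (E : AbelianExtension k H G L) [Fintype L] where
  /-- the action `x ⇀ g` -/
  act : L →* Equiv.Perm G
  /-- the coaction, as an action of `G` on `L` -/
  coact : G →* Equiv.Perm L
  /-- `σ x y g` is `σ_g(x, y)` -/
  σ : L → L → G → kˣ
  /-- `τ x g h` is `τ_{g,h}(x)` -/
  τ : L → G → G → kˣ
  /-- `bar x` is `x̄ = 1 # x` -/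
  bar : L → H
  bijective : Function.Bijective
    (fun w : L → DualGroupAlgebra k G => ∑ x : L, E.incl (w x) * bar x)
  bar_one : bar 1 = 1
  proj_bar : ∀ x : L, E.proj (bar x) = MonoidAlgebra.single x 1
  /-- `bar x * p_g = p_{x ⇀ g} * bar x` -/
  bar_mul_incl : ∀ (x : L) (g : G), bar x * E.incl (DualGroupAlgebra.p k g) =
    E.incl (DualGroupAlgebra.p k (act x g)) * bar x
  /-- `bar x * bar y = σ(x, y) bar (x y)` -/
  bar_mul_bar : ∀ x y : L, bar x * bar y =
    E.incl (∑ g : G, (σ x y g : k) • DualGroupAlgebra.p k g) * bar (x * y)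
  /-- `Δ(bar x) = τ(x) ∑ h, bar (coact h x) ⊗ p_h (bar x)` -/
  comul_bar : ∀ x : L, Coalgebra.comul (R := k) (bar x) =
    ∑ g : G, ∑ h : G, (τ x g h : k) •
      ((E.incl (DualGroupAlgebra.p k g) * bar (coact h x)) ⊗ₜ[k]
        (E.incl (DualGroupAlgebra.p k h) * bar x))

end AbelianExtension

/-! ### Simple characters and Frobenius–Schur indicators -/

section Indicator

universe u v

variable (k : Type u) {H : Type v} [Field k] [Ring H] [HopfAlgebra k H]

/-- The character `h ↦ Tr_V(h)` of an `H`-module `V`. -/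
noncomputable def moduleCharacter (V : Type*) [AddCommGroup V] [Module k V] [Module H V]
    [IsScalarTower k H V] : H →ₗ[k] k :=
  LinearMap.trace k V ∘ₗ (Algebra.lsmul k k V : H →ₐ[k] Module.End k V).toLinearMap

variable (H) in
/-- The set of characters of the simple `H`-modules. (Every simple `H`-module is a quotient of
`H`, so that modules in the universe of `H` suffice.) -/
def simpleCharacters : Set (H →ₗ[k] k) :=
  {χ | ∃ (V : Type v) (_ : AddCommGroup V) (_ : Module k V) (_ : Module H V)
    (_ : IsScalarTower k H V), IsSimpleModule H V ∧ χ = moduleCharacter k V}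

/-- `Λ` is a (two-sided) integral of `H` with `ε(Λ) = 1`. -/
structure IsNormalizedIntegral (Λ : H) : Prop where
  mul_left : ∀ h : H, h * Λ = Coalgebra.counit (R := k) h • Λ
  mul_right : ∀ h : H, Λ * h = Coalgebra.counit (R := k) h • Λ
  counit_eq_one : Coalgebra.counit (R := k) Λ = 1

/-- `Λ^{[2]} = ∑ Λ₁ Λ₂`. -/
noncomputable def sweedlerSquare (Λ : H) : H :=
  LinearMap.mul' k H (Coalgebra.comul (R := k) Λ)

variable {k} in
/-- The Frobenius–Schur indicator `ν(χ) = χ(Λ^{[2]})`, where `Λ` is the normalized integral. -/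
noncomputable def schurIndicator (Λ : H) (χ : H →ₗ[k] k) : k := χ (sweedlerSquare k Λ)

end Indicator

/-!
# Indicators of a cocentral abelian extension

Since `H` is a product of matrix algebras, its regular character is `∑ χ(1) χ`
(`simpleCharacters_finite_and_finsum`), so `∑ ν(χ) χ(1)` is the trace of left multiplication by
`Λ^{[2]} = ∑ Λ₁ Λ₂` on `H`. In the basis `p_g x̄` everything is explicit. Cocentrality forces the
coaction of the bicrossed product to be trivial, and then
* `Λ = |L|⁻¹ ∑ p_1 x̄`, where `|L|` is invertible in `k` because the semisimple algebra `H` has a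
  left integral `t` with `ε(t) = 1`;
* `Λ^{[2]} = |L|⁻¹ ∑ τ_{g,g⁻¹}(x) σ_g(x, x) p_g ȳ` with `y = x²`, the sum being over the `(g, x)`
  with `x ⇀ g⁻¹ = g`;
* left multiplication by `p_g x̄` has trace `|L|` if `x = 1`, and trace `0` otherwise.

Hence the trace is the sum of the `σ_g(x, x) τ_{g,g⁻¹}(x)` over the `(g, x)` with `x² = 1` and
`x ⇀ g = g⁻¹`. Each of these coefficients `c` equals its inverse: comparison of the coefficients of
`p_g ⊗ p_{g⁻¹}` in `Δ(x̄ x̄) = Δ(x̄) Δ(x̄)` gives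
`1 = τ_{g,g⁻¹}(x) τ_{g⁻¹,g}(x) σ_g(x, x) σ_{g⁻¹}(x, x)`, and the right-hand side is `c²` by the
cocycle condition at `(x, x, x)` and the dual cocycle condition at `(g, g⁻¹, g)`
(`AbelianExtension.BicrossedProduct.sigma_mul_tau_mul_self`). In this way the theorem that the
antipode of `H` is an involution, which would give `∑ ν(χ) χ(1) = Tr S`, is not needed.
-/

/-! ### Characters of split semisimple algebras -/

section SplitSemisimple

variable {k A ι : Type*} [Field k] [Ring A] [Algebra k A] {d : ι → ℕ}

/-- The matrix unit `E_{ab}` of the `i`-th block of an algebra `A` identified with a product of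
matrix algebras. -/
def blockUnit [DecidableEq ι] (φ : A ≃ₐ[k] Π i, Matrix (Fin (d i)) (Fin (d i)) k) (i : ι)
    (a b : Fin (d i)) : A :=
  φ.symm (Pi.single i (Matrix.single a b 1))

/-- The linear form taking `x` to the trace of its component in the `i`-th matrix block. -/
def blockTrace (φ : A ≃ₐ[k] Π i, Matrix (Fin (d i)) (Fin (d i)) k) (i : ι) : A →ₗ[k] k :=
  Matrix.traceLinearMap (Fin (d i)) k k ∘ₗ LinearMap.proj i ∘ₗ φ.toLinearMap

variable (φ : A ≃ₐ[k] Π i, Matrix (Fin (d i)) (Fin (d i)) k)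

lemma blockTrace_apply (i : ι) (x : A) : blockTrace φ i x = (φ x i).trace := rfl

variable [DecidableEq ι]

lemma mul_blockUnit (x : A) (i : ι) (a b : Fin (d i)) :
    x * blockUnit φ i a b = ∑ l, φ x i l a • blockUnit φ i l b := by
  apply φ.injective
  simp only [blockUnit, map_mul, AlgEquiv.apply_symm_apply, map_sum, map_smul]
  funext j
  simp only [Pi.mul_apply, Finset.sum_apply, Pi.smul_apply]
  by_cases h : j = i
  · subst h
    simp only [Pi.single_eq_same]
    ext r s
    simp [Matrix.sum_apply, Matrix.mul_apply, Matrix.single_apply, ite_and]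
  · simp [Pi.single_eq_of_ne h]

lemma blockUnit_mul_blockUnit (i : ι) (a b c e : Fin (d i)) :
    blockUnit φ i a b * blockUnit φ i c e = if b = c then blockUnit φ i a e else 0 := by
  rw [mul_blockUnit]
  simp only [blockUnit, AlgEquiv.apply_symm_apply, Pi.single_eq_same, Matrix.single_apply]
  split_ifs with h <;> simp [h]

lemma sum_blockUnit [Fintype ι] : ∑ i, ∑ a, blockUnit φ i a a = 1 := by
  apply φ.injective
  simp only [blockUnit, map_sum, AlgEquiv.apply_symm_apply, map_one]
  funext j
  simp only [Finset.sum_apply]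
  rw [Finset.sum_eq_single j]
  · ext r s
    simp [Matrix.sum_apply, Matrix.single_apply, Matrix.one_apply, ite_and]
  · intro i _ h
    simp [Pi.single_eq_of_ne h.symm]
  · simp

lemma blockTrace_blockUnit (i j : ι) (a : Fin (d j)) :
    blockTrace φ i (blockUnit φ j a a) = if i = j then 1 else 0 := by
  rw [blockTrace_apply, blockUnit, AlgEquiv.apply_symm_apply]
  split_ifs with h
  · subst h
    simp
  · simp [Pi.single_eq_of_ne h]

lemma blockTrace_injective [∀ i, NeZero (d i)] : Function.Injective (blockTrace φ) := by
  intro i j h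
  by_contra hij
  have h1 := blockTrace_blockUnit φ i j 0
  rw [h, blockTrace_blockUnit] at h1
  simp [hij] at h1

/-- The trace of left multiplication on a product of matrix algebras. -/
lemma trace_mulLeft_eq_sum_blockTrace [Fintype ι] (x : A) :
    LinearMap.trace k A (LinearMap.mulLeft k x) =
      ∑ i, blockTrace φ i x * blockTrace φ i 1 := by
  let B := (Pi.basis fun i => Matrix.stdBasis k (Fin (d i)) (Fin (d i))).map φ.symm.toLinearEquiv
  have hB : ∀ i (p : Fin (d i) × Fin (d i)), B ⟨i, p⟩ = blockUnit φ i p.1 p.2 := by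
    rintro i ⟨a, b⟩
    simp [B, blockUnit, Matrix.stdBasis_eq_single]
  rw [LinearMap.trace_eq_matrix_trace k B, Matrix.trace, Fintype.sum_sigma]
  refine Finset.sum_congr rfl fun i _ => ?_
  have h : ∀ p : Fin (d i) × Fin (d i),
      (LinearMap.toMatrix B B (LinearMap.mulLeft k x)).diag ⟨i, p⟩ = φ x i p.1 p.1 := by
    rintro ⟨a, b⟩
    rw [Matrix.diag_apply, LinearMap.toMatrix_apply, LinearMap.mulLeft_apply, hB, mul_blockUnit]
    have : ∀ l, blockUnit φ i l b = B ⟨i, l, b⟩ := fun l => (hB i (l, b)).symm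
    simp only [this, map_sum, map_smul, Module.Basis.repr_self, Finsupp.coe_finsetSum,
      Finset.sum_apply, Finsupp.smul_apply, smul_eq_mul]
    rw [Finset.sum_eq_single a]
    · simp
    · intro l _ hl
      rw [Finsupp.single_eq_of_ne]
      · simp
      · intro h
        simp at h
        exact hl h.symm
    · simp
  rw [Finset.sum_congr rfl fun p _ => h p, Fintype.sum_prod_type]
  simp [blockTrace_apply, Matrix.trace, Finset.mul_sum, mul_comm]

end SplitSemisimple

section SimpleCharacters

variable {k H ι : Type*} [Field k] [Ring H] [HopfAlgebra k H] [DecidableEq ι]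
  {d : ι → ℕ} (φ : H ≃ₐ[k] Π i, Matrix (Fin (d i)) (Fin (d i)) k)

/-- A simple module on which some matrix unit of the `i`-th block acts nontrivially is the column
module of this block: if `w = E_{aa} v ≠ 0`, then the `E_{ja} w` form a basis on which `H` acts
through its `i`-th component. -/
lemma moduleCharacter_eq_blockTrace {V : Type*} [AddCommGroup V] [Module k V] [Module H V]
    [IsScalarTower k H V] [IsSimpleModule H V] (i : ι) (a : Fin (d i)) (v : V)
    (hv : blockUnit φ i a a • v ≠ 0) : moduleCharacter k V = blockTrace φ i := by
  set w := blockUnit φ i a a • v with hw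
  have hww : blockUnit φ i a a • w = w := by
    rw [hw, smul_smul, blockUnit_mul_blockUnit, if_pos rfl]
  let f : Fin (d i) → V := fun j => blockUnit φ i j a • w
  have hf : ∀ (x : H) j, x • f j = ∑ l, φ x i l j • f l := by
    intro x j
    simp only [f]
    rw [smul_smul, mul_blockUnit, Finset.sum_smul]
    simp
  have hli : LinearIndependent k f := by
    rw [Fintype.linearIndependent_iff]
    intro c hc j
    have h1 : blockUnit φ i a j • ∑ l, c l • f l = c j • w := by
      rw [Finset.smul_sum, Finset.sum_eq_single j]
      · simp only [f]
        rw [smul_comm, smul_smul, blockUnit_mul_blockUnit, if_pos rfl, hww]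
      · intro l _ hl
        simp only [f]
        rw [smul_comm, smul_smul, blockUnit_mul_blockUnit, if_neg hl.symm, zero_smul, smul_zero]
      · simp
    rw [hc, smul_zero] at h1
    exact (smul_eq_zero.mp h1.symm).resolve_right hv
  let N : Submodule H V :=
    { Submodule.span k (Set.range f) with
      smul_mem' := by
        intro x u hu
        change u ∈ Submodule.span k (Set.range f) at hu
        change x • u ∈ Submodule.span k (Set.range f)
        induction hu using Submodule.span_induction with
        | mem u hu =>
          obtain ⟨j, rfl⟩ := hu
          rw [hf]
          exact Submodule.sum_mem _ fun l _ =>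
            Submodule.smul_mem _ _ (Submodule.subset_span ⟨l, rfl⟩)
        | zero => simp
        | add u u' _ _ h h' => rw [smul_add]; exact add_mem h h'
        | smul c u _ h =>
          rw [smul_comm]
          exact Submodule.smul_mem _ _ h }
  have hwN : w ∈ N := by
    change w ∈ Submodule.span k (Set.range f)
    exact Submodule.subset_span ⟨a, hww⟩
  have hN : N = ⊤ := by
    rcases eq_bot_or_eq_top N with h | h
    · rw [h, Submodule.mem_bot] at hwN
      exact absurd hwN hv
    · exact h
  have hspan : ⊤ ≤ Submodule.span k (Set.range f) := by
    intro u _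
    have : u ∈ N := hN ▸ Submodule.mem_top
    exact this
  let B := Module.Basis.mk hli hspan
  ext x
  rw [blockTrace_apply, moduleCharacter, LinearMap.comp_apply,
    LinearMap.trace_eq_matrix_trace k B, Matrix.trace, Matrix.trace]
  refine Finset.sum_congr rfl fun j _ => ?_
  rw [Matrix.diag_apply, LinearMap.toMatrix_apply]
  have hB : ∀ l, f l = B l := fun l => (Module.Basis.mk_apply hli hspan l).symm
  have : (Algebra.lsmul k k V : H →ₐ[k] Module.End k V).toLinearMap x (B j) =
      ∑ l, φ x i l j • B l := by
    simp only [← hB]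
    exact hf x j
  rw [this]
  simp [Finsupp.single_apply]

lemma simpleCharacters_eq_range [Fintype ι] [IsSemisimpleRing H] [∀ i, NeZero (d i)] :
    simpleCharacters k H = Set.range (blockTrace φ) := by
  ext χ
  constructor
  · rintro ⟨V, _, _, _, _, hV, rfl⟩
    obtain ⟨v, hv⟩ := @exists_ne V (IsSimpleModule.nontrivial H V) 0
    have h1 : ∑ i, ∑ a, blockUnit φ i a a • v ≠ 0 := by
      simp only [← Finset.sum_smul]
      rwa [sum_blockUnit, one_smul]
    obtain ⟨i, -, hi⟩ := Finset.exists_ne_zero_of_sum_ne_zero h1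
    obtain ⟨a, -, ha⟩ := Finset.exists_ne_zero_of_sum_ne_zero hi
    exact ⟨i, (moduleCharacter_eq_blockTrace φ i a v ha).symm⟩
  · rintro ⟨i, rfl⟩
    -- A simple submodule of the left ideal `H E_{00}` realizes the `i`-th character.
    let N : Submodule H H := Submodule.span H {blockUnit φ i 0 0}
    have hne : blockUnit φ i 0 0 ≠ 0 := by
      intro h
      have := blockTrace_blockUnit φ i i 0
      simp [h] at this
    have : Nontrivial N :=
      ⟨⟨⟨_, Submodule.mem_span_singleton_self _⟩, 0, fun h => hne (congrArg Subtype.val h)⟩⟩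
    obtain ⟨S, hS⟩ := IsSemisimpleModule.exists_simple_submodule H N
    refine ⟨S, inferInstance, inferInstance, inferInstance, inferInstance, hS, ?_⟩
    obtain ⟨v, hv⟩ := @exists_ne S (IsSimpleModule.nontrivial H S) 0
    obtain ⟨x, hx⟩ := Submodule.mem_span_singleton.mp v.1.2
    have hsum : ∑ a, blockUnit φ i a a * (x * blockUnit φ i 0 0) = x * blockUnit φ i 0 0 := by
      rw [mul_blockUnit]
      simp only [Finset.mul_sum, mul_smul_comm, blockUnit_mul_blockUnit]
      simp
    have h1 : ∑ a, blockUnit φ i a a • v ≠ 0 := by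
      intro h
      apply hv
      have h2 := congrArg (fun u : S => ((u : N) : H)) h
      simp only [Submodule.coe_sum, Submodule.coe_smul, ← hx, smul_eq_mul, hsum] at h2
      apply Subtype.ext
      apply Subtype.ext
      rw [← hx]
      exact h2
    obtain ⟨a, -, ha⟩ := Finset.exists_ne_zero_of_sum_ne_zero h1
    exact (moduleCharacter_eq_blockTrace φ i a v ha).symm

/-- Over an algebraically closed field the regular character is `∑ χ(1) χ`. -/
lemma simpleCharacters_finite_and_finsum [IsAlgClosed k] [IsSemisimpleRing H]
    [FiniteDimensional k H] :
    (simpleCharacters k H).Finite ∧ ∀ x : H,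
      ∑ᶠ χ ∈ simpleCharacters k H, χ x * χ 1 = LinearMap.trace k H (LinearMap.mulLeft k x) := by
  obtain ⟨n, d, _, ⟨φ⟩⟩ := IsSemisimpleRing.exists_algEquiv_pi_matrix_of_isAlgClosed k H
  rw [simpleCharacters_eq_range φ]
  refine ⟨Set.finite_range _, fun x => ?_⟩
  rw [finsum_mem_range (blockTrace_injective φ), finsum_eq_sum_of_fintype,
    trace_mulLeft_eq_sum_blockTrace φ]

end SimpleCharacters

/-! ### Integrals of semisimple Hopf algebras -/

section Integral

variable (k : Type*) {H : Type*} [Field k] [Ring H] [HopfAlgebra k H]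

/-- A complement of the augmentation ideal of a semisimple Hopf algebra contains a left integral
which is not killed by the counit. -/
lemma exists_leftIntegral_of_isSemisimpleRing [IsSemisimpleRing H] :
    ∃ t : H, (∀ h : H, h * t = Coalgebra.counit (R := k) h • t) ∧
      Coalgebra.counit (R := k) t = 1 := by
  let I : Ideal H := RingHom.ker (Bialgebra.counitAlgHom k H)
  have hI : ∀ a, a ∈ I ↔ Coalgebra.counit (R := k) a = 0 := fun a => Iff.rfl
  obtain ⟨N, hN⟩ := exists_isCompl I
  have h1 : (1 : H) ∈ I ⊔ N := hN.sup_eq_top ▸ Submodule.mem_top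
  obtain ⟨a, ha, t, ht, hat⟩ := Submodule.mem_sup.mp h1
  have hc : Coalgebra.counit (R := k) t = 1 := by
    have := congrArg (Coalgebra.counit (R := k)) hat
    rwa [map_add, (hI a).mp ha, zero_add, Bialgebra.counit_one] at this
  refine ⟨t, fun h => ?_, hc⟩
  have hd : h * t - Coalgebra.counit (R := k) h • t ∈ I ⊓ N := by
    refine ⟨?_, ?_⟩
    · change _ ∈ I
      rw [hI, map_sub, map_smul, Bialgebra.counit_mul, hc]
      simp
    · refine sub_mem (N.smul_mem h ht) ?_
      rw [Algebra.smul_def]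
      exact N.smul_mem _ ht
  rw [hN.inf_eq_bot, Submodule.mem_bot, sub_eq_zero] at hd
  exact hd

end Integral

/-! ### The basis `p_g x̄` of a bicrossed product -/

namespace AbelianExtension

variable {k H G L : Type*} [Field k] [Ring H] [HopfAlgebra k H]
  [Group G] [Fintype G] [DecidableEq G] [Group L]

lemma counit_incl (E : AbelianExtension k H G L) (w : DualGroupAlgebra k G) :
    Coalgebra.counit (R := k) (E.incl w) = w 1 := by
  rw [CoalgHomClass.counit_comp_apply, DualGroupAlgebra.counit_apply]

/-- The projection is trivial on `K`, since `w - ε(w)` lies in `K⁺`. -/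
lemma proj_incl (E : AbelianExtension k H G L) (w : DualGroupAlgebra k G) :
    E.proj (E.incl w) = w 1 • 1 := by
  have h : E.incl (w - w 1 • 1) ∈ RingHom.ker E.proj := by
    rw [E.ker_proj]
    refine Ideal.subset_span ⟨_, ?_, rfl⟩
    rw [Set.mem_ofPred_eq, map_sub, map_smul, DualGroupAlgebra.counit_apply,
      DualGroupAlgebra.counit_apply]
    change w 1 - w 1 * 1 = 0
    ring
  rw [RingHom.mem_ker, map_sub, map_sub, map_smul, map_smul, map_one, map_one, sub_eq_zero] at h
  exact h

namespace BicrossedProduct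

variable [Fintype L] {E : AbelianExtension k H G L} (P : E.BicrossedProduct)

/-- The basis of `H` formed by the elements `p_g x̄`. -/
noncomputable def basis : Module.Basis (G × L) k H :=
  (Module.Basis.ofEquivFun ((LinearEquiv.curry k k L G).trans (LinearEquiv.ofBijective
    ({ toFun := fun w => ∑ x : L, E.incl (w x) * P.bar x
       map_add' := fun w w' => by
        have h : ∀ x, E.incl ((w + w') x) = E.incl (w x) + E.incl (w' x) := fun x => map_add _ _ _
        simp only [h, add_mul, Finset.sum_add_distrib]
       map_smul' := fun c w => by
        have h : ∀ x, E.incl ((c • w) x) = c • E.incl (w x) := fun x => map_smul E.incl c (w x)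
        simp only [h, smul_mul_assoc, Finset.smul_sum, RingHom.id_apply] } :
      (L → G → k) →ₗ[k] H) P.bijective)).symm).reindex (Equiv.prodComm L G)

lemma basis_apply (g : G) (x : L) :
    P.basis (g, x) = E.incl (DualGroupAlgebra.p k g) * P.bar x := by
  classical
  simp only [basis, Module.Basis.reindex_apply, Equiv.prodComm_symm, Equiv.prodComm_apply,
    Prod.swap_prod_mk, Module.Basis.coe_ofEquivFun, LinearEquiv.symm_symm,
    LinearEquiv.trans_apply]
  change ∑ y : L, E.incl ((LinearEquiv.curry k k L G (Pi.single (x, g) 1) y :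
    DualGroupAlgebra k G)) * P.bar y = _
  rw [Finset.sum_eq_single x]
  · congr 2
    funext h
    rw [DualGroupAlgebra.p_apply]
    simp [LinearEquiv.curry, Pi.single, Function.update_apply]
  · intro y _ hy
    have : (LinearEquiv.curry k k L G) (Pi.single (x, g) 1) y = (0 : DualGroupAlgebra k G) := by
      funext h
      change (Pi.single (x, g) 1 : L × G → k) (y, h) = 0
      simp [hy]
    rw [this, map_zero, zero_mul]
  · simp

lemma sum_basis (x : L) : ∑ g, P.basis (g, x) = P.bar x := by
  simp only [basis_apply, ← Finset.sum_mul, ← map_sum, DualGroupAlgebra.sum_p, map_one, one_mul]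

lemma coord_basis [DecidableEq L] (p q : G × L) :
    P.basis.coord p (P.basis q) = if p = q then 1 else 0 := by
  simp [Module.Basis.coord_apply, Finsupp.single_apply, eq_comm]

lemma coord_bar [DecidableEq L] (g : G) (x y : L) :
    P.basis.coord (g, y) (P.bar x) = if y = x then 1 else 0 := by
  simp [← sum_basis, coord_basis, -Module.Basis.coord_apply, ite_and]

lemma incl_mul_bar (w : DualGroupAlgebra k G) (x : L) :
    E.incl w * P.bar x = ∑ g, w g • P.basis (g, x) := by
  conv_lhs => rw [DualGroupAlgebra.eq_sum w]
  simp only [map_sum, map_smul, Finset.sum_mul, smul_mul_assoc, basis_apply]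

/-- The product `x̄ ȳ` in the basis of `H`. -/
lemma bar_mul_bar_eq_sum (x y : L) :
    P.bar x * P.bar y = ∑ g, (P.σ x y g : k) • P.basis (g, x * y) := by
  simp only [P.bar_mul_bar, map_sum, map_smul, Finset.sum_mul, smul_mul_assoc, basis_apply]

lemma incl_mul_basis (g h : G) (x : L) : E.incl (DualGroupAlgebra.p k g) * P.basis (h, x) =
    if g = h then P.basis (g, x) else 0 := by
  rw [basis_apply, ← mul_assoc, ← map_mul, DualGroupAlgebra.p_mul_p]
  split_ifs with hgh
  · rw [basis_apply]
  · simp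

lemma basis_mul_basis (g h : G) (x y : L) : P.basis (g, x) * P.basis (h, y) =
    if g = P.act x h then (P.σ x y g : k) • P.basis (g, x * y) else 0 := by
  have h1 : P.basis (g, x) * P.basis (h, y) = E.incl (DualGroupAlgebra.p k g) *
      (E.incl (DualGroupAlgebra.p k (P.act x h)) * (P.bar x * P.bar y)) := by
    rw [basis_apply, basis_apply, mul_assoc, ← mul_assoc (P.bar x), P.bar_mul_incl, mul_assoc]
  rw [h1, ← mul_assoc, ← map_mul, DualGroupAlgebra.p_mul_p]
  split_ifs with hg
  · rw [bar_mul_bar_eq_sum, Finset.mul_sum, Finset.sum_eq_single g]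
    · rw [mul_smul_comm, incl_mul_basis, if_pos rfl]
    · intro a _ ha
      rw [mul_smul_comm, incl_mul_basis, if_neg ha.symm, smul_zero]
    · simp
  · simp

lemma counit_bar (x : L) : Coalgebra.counit (R := k) (P.bar x) = 1 := by
  rw [← CoalgHomClass.counit_comp_apply E.proj, P.proj_bar]
  simp

lemma counit_basis (g : G) (x : L) :
    Coalgebra.counit (R := k) (P.basis (g, x)) = if g = 1 then 1 else 0 := by
  rw [basis_apply, Bialgebra.counit_mul, counit_incl, counit_bar, DualGroupAlgebra.p_apply]
  simp [eq_comm]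

lemma act_apply_one (x : L) : P.act x 1 = 1 := by
  have h := congrArg (Coalgebra.counit (R := k)) (P.bar_mul_incl x 1)
  by_contra h1
  rw [Bialgebra.counit_mul, Bialgebra.counit_mul, counit_incl, counit_incl, counit_bar,
    DualGroupAlgebra.p_apply, DualGroupAlgebra.p_apply, if_neg (Ne.symm h1)] at h
  simp at h

lemma sigma_apply_one (x y : L) : (P.σ x y 1 : k) = 1 := by
  have h := congrArg (Coalgebra.counit (R := k)) (P.bar_mul_bar_eq_sum x y)
  simpa [counit_bar, counit_basis] using h.symm

lemma sigma_one_left (y : L) (g : G) : (P.σ 1 y g : k) = 1 := by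
  classical
  have h := congrArg (P.basis.coord (g, y)) (P.bar_mul_bar_eq_sum 1 y)
  rw [P.bar_one, one_mul, one_mul, coord_bar] at h
  simpa [coord_basis, -Module.Basis.coord_apply] using h.symm

/-- For `x² = 1` the element `σ(x, x) = x̄ x̄` commutes with `x̄`, so that `σ(x, x)` is invariant
under `x`. -/
lemma sigma_act (x : L) (hx : x * x = 1) (g : G) : P.σ x x (P.act x g) = P.σ x x g := by
  classical
  have h := mul_assoc (P.bar x) (P.bar x) (P.bar x)
  rw [P.bar_mul_bar, hx, P.bar_one, mul_one, incl_mul_bar] at h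
  have h2 : ∀ a : G, P.bar x * E.incl (DualGroupAlgebra.p k a) = P.basis (P.act x a, x) :=
    fun a => by rw [P.bar_mul_incl, basis_apply]
  simp only [map_sum, map_smul, Finset.mul_sum, mul_smul_comm, h2] at h
  have hs : ∀ a : G, (∑ g, (P.σ x x g : k) • DualGroupAlgebra.p k g :
      DualGroupAlgebra k G) a = P.σ x x a := fun a =>
    congrFun (DualGroupAlgebra.eq_sum (fun g => (P.σ x x g : k))).symm a
  simp only [hs] at h
  have h3 := congrArg (P.basis.coord (P.act x g, x)) h
  simp only [map_sum, map_smul, coord_basis, Prod.mk.injEq, and_true, smul_eq_mul, mul_ite,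
    mul_one, mul_zero, Finset.sum_ite_eq, Finset.mem_univ, if_true, EmbeddingLike.apply_eq_iff_eq]
    at h3
  exact Units.ext h3

/-! ### The comultiplication of a cocentral extension -/

/-- Cocentrality makes the coaction trivial: the linear forms `δ_x ∘ π` and `(p_h x̄)^*` commute,
and their two products take the values `τ_{1,h}(x)`, or `0` if `x` is moved by `h`, and
`τ_{h,1}(x) ≠ 0` at `x̄`. -/
lemma coact_apply_and_tau_one_comm (hE : E.IsCocentral) (x : L) (h : G) :
    P.coact h x = x ∧ P.τ x 1 h = P.τ x h 1 := by
  classical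
  let f : MonoidAlgebra k L →ₗ[k] k := (MonoidAlgebra.basis L k).coord x
  have hf : ∀ y, f (MonoidAlgebra.single y 1) = if y = x then 1 else 0 := by
    intro y
    simp [f, MonoidAlgebra.basis, Finsupp.single_apply]
  have hfp : ∀ (g : G) (y : L), (f ∘ₗ (E.proj : H →ₗ[k] MonoidAlgebra k L)) (P.basis (g, y)) =
      if g = 1 ∧ y = x then 1 else 0 := by
    intro g y
    change f (E.proj (P.basis (g, y))) = _
    rw [basis_apply, map_mul, proj_incl, P.proj_bar, smul_mul_assoc, one_mul, map_smul, hf,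
      DualGroupAlgebra.p_apply]
    by_cases hy : y = x <;> simp [hy, eq_comm]
  have hc := congrArg (fun F : WithConv (H →ₗ[k] k) => F (P.bar x))
    ((Set.mem_center_iff.mp (hE f)).comm (WithConv.toConv (P.basis.coord (h, x)))).eq
  simp only [LinearMap.convMul_apply, P.comul_bar, ← basis_apply] at hc
  simp only [map_sum, map_smul, TensorProduct.map_tmul, LinearMap.mul'_apply, hfp,
    coord_basis, Prod.mk.injEq] at hc
  simp only [ite_and, mul_ite, mul_zero, if_true, smul_eq_mul, mul_one, Finset.sum_ite_eq,
    Finset.sum_ite_eq', Finset.mem_univ, map_one, Equiv.Perm.one_apply] at hc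
  by_cases hx : P.coact h x = x
  · rw [if_pos hx] at hc
    exact ⟨hx, Units.ext hc⟩
  · rw [if_neg hx] at hc
    exact absurd hc.symm (P.τ x h 1).ne_zero

lemma comul_bar_eq_sum (hE : E.IsCocentral) (x : L) : Coalgebra.comul (R := k) (P.bar x) =
    ∑ g, ∑ h, (P.τ x g h : k) • (P.basis (g, x) ⊗ₜ[k] P.basis (h, x)) := by
  simp only [P.comul_bar, (P.coact_apply_and_tau_one_comm hE _ _).1, basis_apply]

lemma comul_basis (hE : E.IsCocentral) (a : G) (x : L) :
    Coalgebra.comul (R := k) (P.basis (a, x)) =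
      ∑ g, (P.τ x g (g⁻¹ * a) : k) • (P.basis (g, x) ⊗ₜ[k] P.basis (g⁻¹ * a, x)) := by
  have h1 : Coalgebra.comul (R := k) (E.incl (DualGroupAlgebra.p k a)) =
      ∑ g, E.incl (DualGroupAlgebra.p k g) ⊗ₜ[k] E.incl (DualGroupAlgebra.p k (g⁻¹ * a)) := by
    rw [← CoalgHomClass.map_comp_comul_apply, DualGroupAlgebra.comul_p, map_sum]
    rfl
  rw [basis_apply, Bialgebra.comul_mul, h1, comul_bar_eq_sum P hE, Finset.sum_mul]
  refine Finset.sum_congr rfl fun g _ => ?_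
  simp only [Finset.mul_sum, mul_smul_comm, Algebra.TensorProduct.tmul_mul_tmul, incl_mul_basis]
  rw [Finset.sum_eq_single g]
  · rw [Finset.sum_eq_single (g⁻¹ * a)]
    · simp
    · intro h _ hh
      simp [hh.symm]
    · simp
  · intro h _ hh
    simp [hh.symm]
  · simp

/-- The linear form on `H` dual to the basis element `p_g x̄`, as an element of the convolution
algebra `H^*`. -/
noncomputable def dualBasis (g : G) (x : L) : WithConv (H →ₗ[k] k) :=
  WithConv.toConv (P.basis.coord (g, x))

lemma dualBasis_apply_basis [DecidableEq L] (g h : G) (x y : L) :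
    P.dualBasis g x (P.basis (h, y)) = if g = h ∧ x = y then 1 else 0 := by
  change P.basis.coord (g, x) (P.basis (h, y)) = _
  simp [coord_basis, -Module.Basis.coord_apply]

/-- In `H^*` the product of dual basis elements is given by `τ`. -/
lemma dualBasis_mul_dualBasis (hE : E.IsCocentral) (g h : G) (x : L) :
    P.dualBasis g x * P.dualBasis h x = (P.τ x g h : k) • P.dualBasis (g * h) x := by
  classical
  apply WithConv.ofConv_injective
  refine P.basis.ext ?_
  rintro ⟨a, y⟩
  change (P.dualBasis g x * P.dualBasis h x) (P.basis (a, y)) =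
    (P.τ x g h : k) • P.dualBasis (g * h) x (P.basis (a, y))
  rw [LinearMap.convMul_apply, comul_basis P hE, dualBasis_apply_basis]
  simp only [map_sum, map_smul, TensorProduct.map_tmul, LinearMap.mul'_apply]
  change ∑ b, (P.τ y b (b⁻¹ * a) : k) • (P.dualBasis g x (P.basis (b, y)) *
    P.dualBasis h x (P.basis (b⁻¹ * a, y))) = _
  simp only [dualBasis_apply_basis]
  by_cases hxy : x = y
  · subst hxy
    rw [Finset.sum_eq_single g]
    · by_cases ha : g * h = a
      · subst ha
        simp
      · have : h ≠ g⁻¹ * a := fun h1 => ha (by rw [h1, mul_inv_cancel_left])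
        simp [ha, this]
    · intro b _ hb
      simp [hb.symm]
    · simp
  · simp [hxy]

/-- The dual cocycle condition at `(g, g⁻¹, g)`, that is, the associativity of
`(p_g x̄)^* (p_{g⁻¹} x̄)^* (p_g x̄)^*` in `H^*`. -/
lemma tau_inv_symm (hE : E.IsCocentral) (x : L) (g : G) : P.τ x g g⁻¹ = P.τ x g⁻¹ g := by
  classical
  have h := congrArg (fun F : WithConv (H →ₗ[k] k) => F (P.basis (g, x)))
    (mul_assoc (P.dualBasis g x) (P.dualBasis g⁻¹ x) (P.dualBasis g x))
  have h1 : (P.dualBasis g x * P.dualBasis g⁻¹ x) * P.dualBasis g x =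
      ((P.τ x g g⁻¹ : k) * P.τ x 1 g) • P.dualBasis g x := by
    rw [dualBasis_mul_dualBasis P hE, smul_mul_assoc, mul_inv_cancel,
      dualBasis_mul_dualBasis P hE, one_mul, smul_smul]
  have h2 : P.dualBasis g x * (P.dualBasis g⁻¹ x * P.dualBasis g x) =
      ((P.τ x g⁻¹ g : k) * P.τ x g 1) • P.dualBasis g x := by
    rw [dualBasis_mul_dualBasis P hE, mul_smul_comm, inv_mul_cancel,
      dualBasis_mul_dualBasis P hE, mul_one, smul_smul]
  rw [h1, h2, (P.coact_apply_and_tau_one_comm hE x g).2] at h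
  change ((P.τ x g g⁻¹ : k) * P.τ x g 1) • P.dualBasis g x (P.basis (g, x)) =
    ((P.τ x g⁻¹ g : k) * P.τ x g 1) • P.dualBasis g x (P.basis (g, x)) at h
  rw [dualBasis_apply_basis] at h
  simp only [and_self, if_true, smul_eq_mul, mul_one] at h
  exact Units.ext (mul_right_cancel₀ (P.τ x g 1).ne_zero h)

lemma tau_one (hE : E.IsCocentral) (g h : G) : (P.τ 1 g h : k) = 1 := by
  classical
  have h1 := congrArg (fun F : WithConv (H →ₗ[k] k) => F (P.bar 1))
    (P.dualBasis_mul_dualBasis hE g h 1)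
  have h2 : ∀ a, P.dualBasis a 1 1 = 1 := by
    intro a
    have := P.coord_bar a 1 1
    rwa [if_pos rfl, P.bar_one] at this
  rw [P.bar_one] at h1
  simp only [LinearMap.convMul_apply, Bialgebra.comul_one, Algebra.TensorProduct.one_def,
    TensorProduct.map_tmul, LinearMap.mul'_apply] at h1
  change P.dualBasis g 1 1 * P.dualBasis h 1 1 = (P.τ 1 g h : k) • P.dualBasis (g * h) 1 1 at h1
  simpa [h2] using h1.symm

/-- The coefficient `σ_g(x, x) τ_{g,g⁻¹}(x)` is a sign, by comparison of the coefficients of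
`p_g ⊗ p_{g⁻¹}` in `Δ(x̄ x̄) = Δ(x̄) Δ(x̄)`. -/
lemma sigma_mul_tau_mul_self (hE : E.IsCocentral) (x : L) (g : G) (hx : x * x = 1)
    (hg : P.act x g = g⁻¹) :
    ((P.σ x x g : k) * P.τ x g g⁻¹) * ((P.σ x x g : k) * P.τ x g g⁻¹) = 1 := by
  classical
  have hg' : P.act x g⁻¹ = g := by
    rw [← hg, ← Equiv.Perm.mul_apply, ← map_mul, hx, map_one, Equiv.Perm.one_apply]
  have hs : P.σ x x g⁻¹ = P.σ x x g := by rw [← hg, sigma_act P x hx]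
  -- The product of the dual basis elements at `g` and `g⁻¹` over `1 = x²` reads off the
  -- coefficient of `p_g ⊗ p_{g⁻¹}`.
  have key := congrArg (fun F : WithConv (H →ₗ[k] k) => F (P.bar x * P.bar x))
    (P.dualBasis_mul_dualBasis hE g g⁻¹ 1)
  have hR : ((P.τ 1 g g⁻¹ : k) • P.dualBasis (g * g⁻¹) 1) (P.bar x * P.bar x) = 1 := by
    change (P.τ 1 g g⁻¹ : k) • (P.dualBasis (g * g⁻¹) 1) (P.bar x * P.bar x) = 1
    rw [tau_one P hE, mul_inv_cancel, one_smul, bar_mul_bar_eq_sum, map_sum]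
    simp only [map_smul, dualBasis_apply_basis, hx]
    simp [sigma_apply_one]
  rw [hR] at key
  rw [LinearMap.convMul_apply, Bialgebra.comul_mul, comul_bar_eq_sum P hE] at key
  simp only [Finset.sum_mul, Finset.mul_sum, smul_mul_assoc, mul_smul_comm,
    Algebra.TensorProduct.tmul_mul_tmul, basis_mul_basis, map_sum, map_smul,
    TensorProduct.map_tmul, LinearMap.mul'_apply, hx] at key
  have hiff : ∀ a b, a = P.act x b ↔ P.act x a = b := fun a b => by
    rw [← (P.act x).injective.eq_iff, ← Equiv.Perm.mul_apply, ← map_mul, hx, map_one,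
      Equiv.Perm.one_apply]
  have hd : ∀ c a b : G, (P.dualBasis c 1).ofConv
      (if a = P.act x b then (P.σ x x a : k) • P.basis (a, 1) else 0) =
      if c = a then if P.act x c = b then (P.σ x x c : k) else 0 else 0 := by
    intro c a b
    rw [apply_ite (P.dualBasis c 1).ofConv, map_zero, map_smul]
    change (if _ then _ • P.dualBasis c 1 (P.basis (a, 1)) else 0) = _
    rw [dualBasis_apply_basis]
    by_cases h : c = a
    · subst h
      simp [hiff]
    · simp [h]
  simp only [hd, mul_ite, ite_mul, zero_mul, mul_zero, smul_eq_mul, Finset.sum_ite_eq,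
    Finset.mem_univ, if_true, hg, hg', hs, Finset.sum_ite_irrel, Finset.sum_const_zero] at key
  rw [← key, ← tau_inv_symm P hE]
  ring

/-! ### The normalized integral and its Sweedler square -/

lemma mul_sum_basis_one (h : H) :
    h * ∑ x, P.basis (1, x) = Coalgebra.counit (R := k) h • ∑ x, P.basis (1, x) := by
  have hl : LinearMap.mulRight k (∑ x, P.basis (1, x)) =
      (Coalgebra.counit (R := k) (A := H)).smulRight (∑ x, P.basis (1, x)) := by
    refine P.basis.ext ?_
    rintro ⟨g, x⟩
    rw [LinearMap.mulRight_apply, LinearMap.smulRight_apply, counit_basis, Finset.mul_sum]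
    simp only [basis_mul_basis, act_apply_one]
    split_ifs with hg
    · subst hg
      simp only [sigma_apply_one, one_smul]
      exact Fintype.sum_equiv (Equiv.mulLeft x) _ _ fun _ => rfl
    · simp
  exact LinearMap.congr_fun hl h

lemma sum_basis_one_mul (h : H) :
    (∑ x, P.basis (1, x)) * h = Coalgebra.counit (R := k) h • ∑ x, P.basis (1, x) := by
  have hl : LinearMap.mulLeft k (∑ x, P.basis (1, x)) =
      (Coalgebra.counit (R := k) (A := H)).smulRight (∑ x, P.basis (1, x)) := by
    refine P.basis.ext ?_
    rintro ⟨g, x⟩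
    rw [LinearMap.mulLeft_apply, LinearMap.smulRight_apply, counit_basis, Finset.sum_mul]
    have h1 : ∀ y, (1 : G) = P.act y g ↔ g = 1 := fun y => by
      rw [eq_comm, ← (P.act y).injective.eq_iff (a := g), act_apply_one]
    simp only [basis_mul_basis, h1]
    split_ifs with hg
    · simp only [sigma_apply_one, one_smul]
      exact Fintype.sum_equiv (Equiv.mulRight x) _ _ fun _ => rfl
    · simp
  exact LinearMap.congr_fun hl h

lemma sum_basis_one_ne_zero : ∑ x, P.basis (1, x) ≠ 0 := by
  classical
  intro h
  have := congrArg (P.basis.coord (1, 1)) h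
  simp [coord_basis, -Module.Basis.coord_apply] at this

lemma counit_sum_basis_one :
    Coalgebra.counit (R := k) (∑ x, P.basis (1, x)) = (Fintype.card L : k) := by
  simp [counit_basis]

/-- `∑ p_1 x̄` is nonzero, and equals `∑ p_1 x̄ * t = |L| t` for a normalized left integral `t`. -/
lemma card_ne_zero_of_isSemisimpleRing (P : E.BicrossedProduct) [IsSemisimpleRing H] :
    (Fintype.card L : k) ≠ 0 := by
  obtain ⟨t, ht, ht1⟩ := exists_leftIntegral_of_isSemisimpleRing k (H := H)
  intro h0
  have h := ht (∑ x, P.basis (1, x))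
  rw [sum_basis_one_mul, ht1, one_smul, counit_sum_basis_one, h0, zero_smul] at h
  exact P.sum_basis_one_ne_zero h

/-- The element `|L|⁻¹ ∑ p_1 x̄`, which is the normalized integral if `H` is semisimple (otherwise
`|L|` may vanish in `k`, and then this is `0`). -/
noncomputable def integral : H := (Fintype.card L : k)⁻¹ • ∑ x, P.basis (1, x)

lemma isNormalizedIntegral_integral [IsSemisimpleRing H] : IsNormalizedIntegral k P.integral where
  mul_left h := by rw [integral, mul_smul_comm, mul_sum_basis_one, smul_comm]
  mul_right h := by rw [integral, smul_mul_assoc, sum_basis_one_mul, smul_comm]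
  counit_eq_one := by
    rw [integral, map_smul, counit_sum_basis_one, smul_eq_mul,
      inv_mul_cancel₀ P.card_ne_zero_of_isSemisimpleRing]

lemma sweedlerSquare_integral (hE : E.IsCocentral) : sweedlerSquare k P.integral =
    (Fintype.card L : k)⁻¹ • ∑ x, ∑ g, if P.act x g⁻¹ = g then
      ((P.τ x g g⁻¹ : k) * P.σ x x g) • P.basis (g, x * x) else 0 := by
  rw [sweedlerSquare, integral, map_smul, map_smul, map_sum, map_sum]
  simp only [comul_basis P hE, map_sum, map_smul, LinearMap.mul'_apply, basis_mul_basis, mul_one,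
    smul_ite, smul_smul, smul_zero, eq_comm]

lemma trace_mulLeft_basis [DecidableEq L] (g : G) (x : L) :
    LinearMap.trace k H (LinearMap.mulLeft k (P.basis (g, x))) =
      if x = 1 then (Fintype.card L : k) else 0 := by
  rw [LinearMap.trace_eq_matrix_trace k P.basis, Matrix.trace]
  have h1 : ∀ p : G × L, (LinearMap.toMatrix P.basis P.basis
      (LinearMap.mulLeft k (P.basis (g, x)))).diag p = if p.1 = g ∧ x = 1 then 1 else 0 := by
    rintro ⟨h, y⟩
    rw [Matrix.diag_apply, LinearMap.toMatrix_apply, LinearMap.mulLeft_apply, basis_mul_basis,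
      ← Module.Basis.coord_apply]
    by_cases hx : x = 1
    · subst hx
      by_cases hg : g = h
      · subst hg
        simp [coord_basis, sigma_one_left, -Module.Basis.coord_apply]
      · simp [hg, Ne.symm hg]
    · have hne : ¬((h, y).1 = g ∧ x = 1) := fun h => hx h.2
      rw [if_neg hne]
      split_ifs
      · simp [coord_basis, hx, -Module.Basis.coord_apply]
      · exact map_zero _
  rw [Finset.sum_congr rfl fun p _ => h1 p, Fintype.sum_prod_type]
  by_cases hx : x = 1 <;> simp [hx]

/-- The trace of `Λ^{[2]}` is a sum of the `σ_g(x, x) τ_{g,g⁻¹}(x)`, which are signs and so agree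
with their inverses. -/
lemma trace_mulLeft_sweedlerSquare_integral [DecidableEq L] [IsSemisimpleRing H]
    (hE : E.IsCocentral) :
    LinearMap.trace k H (LinearMap.mulLeft k (sweedlerSquare k P.integral)) =
      ∑ q : G × L with q.2 ^ 2 = 1 ∧ P.act q.2 q.1 = q.1⁻¹,
        ((P.σ q.2 q.2 q.1 : k)⁻¹ * (P.τ q.2 q.1 q.1⁻¹ : k)⁻¹) := by
  have hlin : ∀ a : H, LinearMap.trace k H (LinearMap.mulLeft k a) =
      (LinearMap.trace k H ∘ₗ LinearMap.mul k H) a := fun a => rfl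
  rw [hlin, sweedlerSquare_integral P hE]
  simp only [map_smul, map_sum, apply_ite (LinearMap.trace k H ∘ₗ LinearMap.mul k H), map_zero]
  simp only [← hlin, trace_mulLeft_basis]
  rw [Finset.sum_filter, Fintype.sum_prod_type_right, Finset.smul_sum]
  refine Finset.sum_congr rfl fun x _ => ?_
  rw [Finset.smul_sum]
  refine Finset.sum_congr rfl fun g _ => ?_
  have hcard : (Fintype.card L : k) ≠ 0 := P.card_ne_zero_of_isSemisimpleRing
  by_cases hx : x * x = 1
  · have hiff : P.act x g⁻¹ = g ↔ P.act x g = g⁻¹ := by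
      have hinv : ∀ a, P.act x (P.act x a) = a := fun a => by
        rw [← Equiv.Perm.mul_apply, ← map_mul, hx, map_one, Equiv.Perm.one_apply]
      exact ⟨fun h => by rw [← h, hinv, h], fun h => by rw [← h, hinv]⟩
    by_cases hg : P.act x g = g⁻¹
    · have hsq := P.sigma_mul_tau_mul_self hE x g hx hg
      rw [if_pos (hiff.mpr hg), if_pos hx, if_pos (And.intro ((sq x).trans hx) hg), smul_eq_mul,
        smul_eq_mul, ← mul_inv, ← eq_inv_of_mul_eq_one_left hsq]
      field_simp
    · rw [if_neg fun h => hg (hiff.mp h), if_neg fun h => hg h.2, smul_zero]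
  · have hx' : ¬ (x ^ 2 = 1) := by rwa [sq]
    simp [hx, hx']

end BicrossedProduct

end AbelianExtension

theorem proposition4p3 {k H G L : Type*} [Field k] [IsAlgClosed k] (hk : (2 : k) ≠ 0)
    [Ring H] [HopfAlgebra k H]
    [Group G] [Fintype G] [DecidableEq G] [Group L] [Fintype L] [DecidableEq L]
    (hss : IsSemisimpleRing H)
    (hcoss : ringChar k ≠ 0 → IsSemisimpleRing (WithConv (H →ₗ[k] k)))
    (E : AbelianExtension k H G L) (hE : E.IsCocentral) (P : E.BicrossedProduct) :
    (∃! Λ : H, IsNormalizedIntegral k Λ) ∧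
    (simpleCharacters k H).Finite ∧
    ∀ Λ : H, IsNormalizedIntegral k Λ →
      (∑ᶠ χ ∈ simpleCharacters k H, schurIndicator Λ χ * χ 1 =
        ∑ q : G × L with q.2 ^ 2 = 1 ∧ P.act q.2 q.1 = q.1⁻¹,
          ((P.σ q.2 q.2 q.1 : k)⁻¹ * (P.τ q.2 q.1 q.1⁻¹ : k)⁻¹)) ∧
      ((∀ x y g, P.σ x y g = 1) → (∀ x g h, P.τ x g h = 1) →
        ∑ᶠ χ ∈ simpleCharacters k H, schurIndicator Λ χ * χ 1 =
          (({q : G × L | q.2 ^ 2 = 1 ∧ P.act q.2 q.1 = q.1⁻¹} : Finset (G × L)).card : k)) := by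
  have hΛ := P.isNormalizedIntegral_integral
  have huniq : ∀ Λ : H, IsNormalizedIntegral k Λ → Λ = P.integral := by
    intro Λ h
    have h1 := h.mul_right P.integral
    rwa [hΛ.mul_left, h.counit_eq_one, hΛ.counit_eq_one, one_smul, one_smul, eq_comm] at h1
  have : FiniteDimensional k H := P.basis.finiteDimensional_of_finite
  obtain ⟨hfin, hsum⟩ := simpleCharacters_finite_and_finsum (k := k) (H := H)
  refine ⟨⟨P.integral, hΛ, huniq⟩, hfin, fun Λ h => ?_⟩
  have hmain : ∑ᶠ χ ∈ simpleCharacters k H, schurIndicator Λ χ * χ 1 =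
      ∑ q : G × L with q.2 ^ 2 = 1 ∧ P.act q.2 q.1 = q.1⁻¹,
        ((P.σ q.2 q.2 q.1 : k)⁻¹ * (P.τ q.2 q.1 q.1⁻¹ : k)⁻¹) := by
    rw [huniq Λ h, ← P.trace_mulLeft_sweedlerSquare_integral hE]
    exact hsum _
  refine ⟨hmain, fun hσ hτ => ?_⟩
  rw [hmain]
  simp [hσ, hτ]
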